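/- Let $\epsilon\in\{-1,1\}$. An affine special $\epsilon$-Kähler manifold $(M,J,g,\nabla)$ is a smooth manifold $M$ with a pseudo-Riemannian metric $g$ with Levi-Civita connection $D$, a $g$-skew-symmetric endomorphism field $J\in\Gamma(\mathrm{End}\,TM)$ with $J^2=\epsilon\,\mathrm{Id}$ and $DJ=0$, and a flat torsion-free connection $\nabla$ such that $\nabla\omega=0$, where $\omega=\epsilon\, g(J\cdot,\cdot)$ is the Kähler form, and such that $(\nabla_XJ)Y=(\nabla_YJ)X$ for all vector fields $X,Y$. It is called conical, and denoted $(M,J,g,\nabla,\xi)$, if it is endowed with a smooth vector field $\xi$ such that $\nabla\xi=D\xi=\mathrm{Id}$. Proposition. Let $(M,J,g,\nabla,\xi)$ be a conical affine special $\epsilon$-Kähler manifold, let $L$ denote the Lie derivative, and for a 1-form $\alpha$ put $J^*\alpha=\alpha\circ J$. Then the following holds: (i) $L_\xi X=-X$ and $L_\xi(JX)=-JX$ for all $\nabla$-parallel local vector fields $X$; (ii) $L_\xi\alpha=\alpha$ and $L_\xi(J^*\alpha)=J^*\alpha$ for all $\nabla$-parallel local 1-forms $\alpha$; (iii) $L_\xi\omega=2\omega$,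 $L_\xi g=2g$ and $L_\xi J=0$; (iv) $L_{J\xi}\omega=0$, $L_{J\xi}g=0$ and $L_{J\xi}J=0$. -/

import Mathlib

open scoped Manifold ContDiff Topology Bundle
open VectorField

noncomputable section

namespace SpecialKaehler

variable {E : Type*} [NormedAddCommGroup E] [NormedSpace ℝ E]
  {M : Type*} [TopologicalSpace M] [ChartedSpace E M]

variable (E M) in
/-- Vector fields on `M` (a priori without any regularity). -/
abbrev VField : Type _ := Π x : M, TangentSpace 𝓘(ℝ, E) x

variable (E M) in
/-- 1-forms on `M`. -/
abbrev OneForm : Type _ := Π x : M, TangentSpace 𝓘(ℝ, E) x →L[ℝ] ℝ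

variable (E M) in
/-- `(0,2)`-tensor fields on `M`. -/
abbrev Bilin : Type _ :=
  Π x : M, TangentSpace 𝓘(ℝ, E) x →L[ℝ] TangentSpace 𝓘(ℝ, E) x →L[ℝ] ℝ

variable (E M) in
/-- Endomorphism fields of `TM`. -/
abbrev Endo : Type _ :=
  Π x : M, TangentSpace 𝓘(ℝ, E) x →L[ℝ] TangentSpace 𝓘(ℝ, E) x

/-! ### Pointwise algebra -/

/-- The vector field `J X`. -/
def Endo.onField (J : Endo E M) (X : VField E M) : VField E M := fun x => J x (X x)

/-- The 1-form `J^* α = α ∘ J`. -/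
def Endo.pullback (J : Endo E M) (α : OneForm E M) : OneForm E M := fun x => (α x).comp (J x)

/-- The function `α(Y)`. -/
def OneForm.eval (α : OneForm E M) (Y : VField E M) : M → ℝ := fun x => α x (Y x)

/-- The function `b(Y, Z)`. -/
def Bilin.eval (b : Bilin E M) (Y Z : VField E M) : M → ℝ := fun x => b x (Y x) (Z x)

/-- The Kähler form `ω = ε g(J·, ·)`. -/
def kaehlerForm (ε : ℝ) (g : Bilin E M) (J : Endo E M) : Bilin E M :=
  fun x => ε • (g x).comp (J x)

/-! ### Smooth sections -/

section Smooth

variable [IsManifold 𝓘(ℝ, E) ∞ M]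

/-- `X` is a smooth vector field on the set `U`. -/
def SmoothFieldOn (X : VField E M) (U : Set M) : Prop :=
  ContMDiffOn 𝓘(ℝ, E) (𝓘(ℝ, E).prod 𝓘(ℝ, E)) ∞
    (fun x => (Bundle.TotalSpace.mk' E x (X x) : TangentBundle 𝓘(ℝ, E) M)) U

/-- The vector field `X` is differentiable at the point `x`. -/
def DiffFieldAt (X : VField E M) (x : M) : Prop :=
  MDifferentiableAt 𝓘(ℝ, E) (𝓘(ℝ, E).prod 𝓘(ℝ, E))
    (fun x => (Bundle.TotalSpace.mk' E x (X x) : TangentBundle 𝓘(ℝ, E) M)) x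

/-- `α` is a smooth 1-form on the set `U`. -/
def SmoothOneFormOn (α : OneForm E M) (U : Set M) : Prop :=
  ContMDiffOn 𝓘(ℝ, E) (𝓘(ℝ, E).prod 𝓘(ℝ, E →L[ℝ] ℝ)) ∞
    (fun x => Bundle.TotalSpace.mk' (E →L[ℝ] ℝ)
      (E := fun x : M => TangentSpace 𝓘(ℝ, E) x →L[ℝ] Bundle.Trivial M ℝ x) x (α x)) U

/-- `J` is a smooth endomorphism field. -/
def SmoothEndo (J : Endo E M) : Prop :=
  ContMDiff 𝓘(ℝ, E) (𝓘(ℝ, E).prod 𝓘(ℝ, E →L[ℝ] E)) ∞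
    (fun x => Bundle.TotalSpace.mk' (E →L[ℝ] E)
      (E := fun x : M => TangentSpace 𝓘(ℝ, E) x →L[ℝ] TangentSpace 𝓘(ℝ, E) x) x (J x))

/-- `b` is a smooth `(0,2)`-tensor field. -/
def SmoothBilin (b : Bilin E M) : Prop :=
  ContMDiff 𝓘(ℝ, E) (𝓘(ℝ, E).prod 𝓘(ℝ, E →L[ℝ] E →L[ℝ] ℝ)) ∞
    (fun x => Bundle.TotalSpace.mk' (E →L[ℝ] E →L[ℝ] ℝ)
      (E := fun x : M =>
        TangentSpace 𝓘(ℝ, E) x →L[ℝ] TangentSpace 𝓘(ℝ, E) x →L[ℝ] Bundle.Trivial M ℝ x)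
      x (b x))

end Smooth

/-! ### Lie derivatives

For tensor fields, `L_ξ` is given by its values on vector fields `Y`, `Z`, through the Leibniz
rule. -/

/-- The derivative `ξ(f)` of a function along a vector field. -/
def derivAlong (ξ : VField E M) (f : M → ℝ) : M → ℝ := fun x => mvfderiv 𝓘(ℝ, E) f x (ξ x)

/-- `L_ξ X = [ξ, X]`. -/
def lieField (ξ X : VField E M) : VField E M := mlieBracket 𝓘(ℝ, E) ξ X

/-- `(L_ξ α)(Y) = ξ(α(Y)) - α(L_ξ Y)`. -/
def lieOneForm (ξ : VField E M) (α : OneForm E M) (Y : VField E M) : M → ℝ :=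
  fun x => derivAlong ξ (α.eval Y) x - α x (lieField ξ Y x)

/-- `(L_ξ b)(Y, Z) = ξ(b(Y, Z)) - b(L_ξ Y, Z) - b(Y, L_ξ Z)`. -/
def lieBilin (ξ : VField E M) (b : Bilin E M) (Y Z : VField E M) : M → ℝ :=
  fun x => derivAlong ξ (b.eval Y Z) x - b x (lieField ξ Y x) (Z x) - b x (Y x) (lieField ξ Z x)

/-- `(L_ξ J)(Y) = L_ξ (J Y) - J (L_ξ Y)`. -/
def lieEndo (ξ : VField E M) (J : Endo E M) (Y : VField E M) : VField E M :=
  fun x => lieField ξ (J.onField Y) x - J x (lieField ξ Y x)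

/-! ### Connections -/

section Connections

variable [IsManifold 𝓘(ℝ, E) ∞ M]

variable (E M) in
/-- Connections on `TM`; `∇ Y x v` is `∇_v Y` at `x`. -/
abbrev Connection : Type _ :=
  CovariantDerivative 𝓘(ℝ, E) E (fun x : M => TangentSpace 𝓘(ℝ, E) x)

/-- `∇_X Y - ∇_Y X = [X, Y]`. -/
def IsTorsionFree (nabla : Connection E M) : Prop :=
  ∀ (X Y : VField E M) (x : M), DiffFieldAt X x → DiffFieldAt Y x →
    nabla Y x (X x) - nabla X x (Y x) = mlieBracket 𝓘(ℝ, E) X Y x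

/-- `R(X,Y)Z = ∇_X ∇_Y Z - ∇_Y ∇_X Z - ∇_[X,Y] Z`. -/
def curvature (nabla : Connection E M) (X Y Z : VField E M) : VField E M :=
  fun x => nabla (fun y => nabla Z y (Y y)) x (X x) - nabla (fun y => nabla Z y (X y)) x (Y x)
    - nabla Z x (mlieBracket 𝓘(ℝ, E) X Y x)

/-- `R = 0`. -/
def IsFlat (nabla : Connection E M) : Prop :=
  ∀ X Y Z : VField E M, SmoothFieldOn X Set.univ → SmoothFieldOn Y Set.univ →
    SmoothFieldOn Z Set.univ → ∀ x, curvature nabla X Y Z x = 0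

/-- `∇ b = 0`, i.e. `v(b(Y,Z)) = b(∇_v Y, Z) + b(Y, ∇_v Z)`. -/
def ParallelBilin (nabla : Connection E M) (b : Bilin E M) : Prop :=
  ∀ (Y Z : VField E M) (x : M), DiffFieldAt Y x → DiffFieldAt Z x →
    ∀ v : TangentSpace 𝓘(ℝ, E) x,
      mvfderiv 𝓘(ℝ, E) (b.eval Y Z) x v = b x (nabla Y x v) (Z x) + b x (Y x) (nabla Z x v)

/-- `(∇_X J) Y = ∇_X (J Y) - J (∇_X Y)`. -/
def covDerivEndo (nabla : Connection E M) (J : Endo E M) (X Y : VField E M) : VField E M :=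
  fun x => nabla (J.onField Y) x (X x) - J x (nabla Y x (X x))

/-- `∇ X = 0` on `U`. -/
def ParallelFieldOn (nabla : Connection E M) (X : VField E M) (U : Set M) : Prop :=
  ∀ x ∈ U, ∀ v : TangentSpace 𝓘(ℝ, E) x, nabla X x v = 0

/-- `∇ α = 0` on `U`, i.e. `v(α(Y)) = α(∇_v Y)`. -/
def ParallelOneFormOn (nabla : Connection E M) (α : OneForm E M) (U : Set M) : Prop :=
  ∀ x ∈ U, ∀ Y : VField E M, DiffFieldAt Y x →
    ∀ v : TangentSpace 𝓘(ℝ, E) x, mvfderiv 𝓘(ℝ, E) (α.eval Y) x v = α x (nabla Y x v)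

/-! ### The geometric structures -/

/-- `g` is a pseudo-Riemannian metric: smooth, symmetric and nondegenerate. -/
structure IsPseudoRiemannian (g : Bilin E M) : Prop where
  smooth : SmoothBilin g
  symm : ∀ x v w, g x v w = g x w v
  nondegenerate : ∀ x v, (∀ w, g x v w = 0) → v = 0

/-- `D` is the Levi-Civita connection of `g`. -/
structure IsLeviCivita (g : Bilin E M) (D : Connection E M) : Prop where
  torsionFree : IsTorsionFree D
  metric : ParallelBilin D g

/-- `(M, J, g)` is an `ε`-Kähler manifold, with Levi-Civita connection `D`. -/
structure IsEpsKaehler (ε : ℝ) (J : Endo E M) (g : Bilin E M) (D : Connection E M) : Prop where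
  eps : ε = -1 ∨ ε = 1
  pseudoRiemannian : IsPseudoRiemannian g
  leviCivita : IsLeviCivita g D
  smooth : SmoothEndo J
  sq : ∀ x v, J x (J x v) = ε • v
  skew : ∀ x v w, g x (J x v) w = - g x v (J x w)
  parallel : ∀ (X Y : VField E M) (x : M), DiffFieldAt X x → DiffFieldAt Y x →
    covDerivEndo D J X Y x = 0

/-- `(M, J, g, ∇)` is an affine special `ε`-Kähler manifold, with Levi-Civita connection `D`. -/
structure IsAffineSpecialEpsKaehler (ε : ℝ) (J : Endo E M) (g : Bilin E M)
    (D nabla : Connection E M) : Prop extends IsEpsKaehler ε J g D where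
  smooth_nabla : CovariantDerivative.ContMDiffCovariantDerivative nabla ∞
  torsionFree : IsTorsionFree nabla
  flat : IsFlat nabla
  symplectic : ParallelBilin nabla (kaehlerForm ε g J)
  symmetric : ∀ (X Y : VField E M) (x : M), DiffFieldAt X x → DiffFieldAt Y x →
    covDerivEndo nabla J X Y x = covDerivEndo nabla J Y X x

/-- `(M, J, g, ∇, ξ)` is a conical affine special `ε`-Kähler manifold, with Levi-Civita
connection `D`: moreover `∇ ξ = D ξ = Id`. -/
structure IsConicalAffineSpecialEpsKaehler (ε : ℝ) (J : Endo E M) (g : Bilin E M)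
    (D nabla : Connection E M) (ξ : VField E M) : Prop
    extends IsAffineSpecialEpsKaehler ε J g D nabla where
  smooth_xi : SmoothFieldOn ξ Set.univ
  nabla_xi : ∀ (x : M) (v : TangentSpace 𝓘(ℝ, E) x), nabla ξ x v = v
  D_xi : ∀ (x : M) (v : TangentSpace 𝓘(ℝ, E) x), D ξ x v = v

end Connections

end SpecialKaehler

end

namespace SpecialKaehler

variable {E : Type*} [NormedAddCommGroup E] [NormedSpace ℝ E]
  {M : Type*} [TopologicalSpace M] [ChartedSpace E M] [IsManifold 𝓘(ℝ, E) ∞ M]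

/-! For a torsion-free connection, `L_ξ Y = ∇_ξ Y - ∇_Y ξ`, so the Lie derivative of a parallel
tensor along any field `ζ` is the algebraic action of the endomorphism `∇ζ` on it. For `ζ = ξ` this
endomorphism is `Id`, which gives the weights. The two connections are linked by `J`: `DJ = 0`
yields `L_ξ J = 0`; computing `L_ξ J` again with `∇` yields `∇_ξ J = 0`; the symmetry of `∇J` then
yields `∇(Jξ) = J`, and `D(Jξ) = J` is immediate. So along `Jξ` the acting endomorphism is `J`,
which is skew for `ω` and `g` and commutes with itself. -/

/-- A field which is smooth on an open set is differentiable at its points. -/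
theorem SmoothFieldOn.diffFieldAt {X : VField E M} {U : Set M} (hX : SmoothFieldOn X U)
    (hU : IsOpen U) {x : M} (hx : x ∈ U) : DiffFieldAt X x :=
  ContMDiffAt.mdifferentiableAt (ContMDiffOn.contMDiffAt hX (hU.mem_nhds hx)) (by simp)

/-- A smooth endomorphism field maps differentiable fields to differentiable fields. -/
theorem SmoothEndo.diffFieldAt_onField {J : Endo E M} (hJ : SmoothEndo J) {Y : VField E M} {x : M}
    (hY : DiffFieldAt Y x) : DiffFieldAt (J.onField Y) x :=
  MDifferentiableAt.clm_bundle_apply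
    (ContMDiffAt.mdifferentiableAt (ContMDiff.contMDiffAt hJ) (by simp)) hY

/-- The Lie derivative of a field along `ξ`, when `∇ξ` is known. -/
theorem IsTorsionFree.lieField_eq {nabla : Connection E M} (h : IsTorsionFree nabla)
    {ξ Y : VField E M} {x : M} (hξ : DiffFieldAt ξ x) (hY : DiffFieldAt Y x) :
    lieField ξ Y x = nabla Y x (ξ x) - nabla ξ x (Y x) :=
  (h ξ Y x hξ hY).symm

/-- The Lie derivative of a parallel bilinear form, in terms of a torsion-free connection. -/
theorem ParallelBilin.lieBilin_eq {nabla : Connection E M} {b : Bilin E M}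
    (hb : ParallelBilin nabla b) (h : IsTorsionFree nabla) {ξ Y Z : VField E M} {x : M}
    (hξ : DiffFieldAt ξ x) (hY : DiffFieldAt Y x) (hZ : DiffFieldAt Z x) :
    lieBilin ξ b Y Z x = b x (nabla ξ x (Y x)) (Z x) + b x (Y x) (nabla ξ x (Z x)) := by
  have e : derivAlong ξ (b.eval Y Z) x = _ := hb Y Z x hY hZ (ξ x)
  -- The terms in `∇_ξ Y` and `∇_ξ Z` cancel, leaving only those in `∇ξ`.
  rw [lieBilin, e, h.lieField_eq hξ hY, h.lieField_eq hξ hZ, map_sub, map_sub,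
    sub_apply]
  ring

/-- The Lie derivative of an endomorphism field, in terms of a torsion-free connection. -/
theorem IsTorsionFree.lieEndo_eq {nabla : Connection E M} (h : IsTorsionFree nabla)
    {J : Endo E M} (hJ : SmoothEndo J) {ξ Y : VField E M} {x : M}
    (hξ : DiffFieldAt ξ x) (hY : DiffFieldAt Y x) :
    lieEndo ξ J Y x =
      covDerivEndo nabla J ξ Y x - nabla ξ x (J x (Y x)) + J x (nabla ξ x (Y x)) := by
  rw [lieEndo, h.lieField_eq hξ (hJ.diffFieldAt_onField hY), h.lieField_eq hξ hY, map_sub,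
    covDerivEndo]
  simp only [Endo.onField]
  abel

/-- The Lie derivative of a parallel 1-form, in terms of a torsion-free connection. -/
theorem ParallelOneFormOn.lieOneForm_eq {nabla : Connection E M} {α : OneForm E M} {U : Set M}
    (hα : ParallelOneFormOn nabla α U) (h : IsTorsionFree nabla) {ξ Y : VField E M} {x : M}
    (hx : x ∈ U) (hξ : DiffFieldAt ξ x) (hY : DiffFieldAt Y x) :
    lieOneForm ξ α Y x = α x (nabla ξ x (Y x)) := by
  have e : derivAlong ξ (α.eval Y) x = _ := hα x hx Y hY (ξ x)
  rw [lieOneForm, e, h.lieField_eq hξ hY, map_sub]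
  ring

namespace IsConicalAffineSpecialEpsKaehler

variable {ε : ℝ} {J : Endo E M} {g : Bilin E M} {D nabla : Connection E M} {ξ : VField E M}

theorem diffFieldAt_xi (h : IsConicalAffineSpecialEpsKaehler ε J g D nabla ξ) (x : M) : DiffFieldAt ξ x :=
  h.smooth_xi.diffFieldAt isOpen_univ (Set.mem_univ x)

/-- `L_ξ J = 0`. -/
theorem lieEndo_xi (h : IsConicalAffineSpecialEpsKaehler ε J g D nabla ξ)
    {x : M} {Y : VField E M} (hY : DiffFieldAt Y x) : lieEndo ξ J Y x = 0 := by
  rw [h.leviCivita.torsionFree.lieEndo_eq h.smooth (h.diffFieldAt_xi x) hY,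
    h.parallel ξ Y x (h.diffFieldAt_xi x) hY, h.D_xi, h.D_xi]
  abel

/-- `∇_ξ J = 0`. -/
theorem covDerivEndo_xi (h : IsConicalAffineSpecialEpsKaehler ε J g D nabla ξ)
    {x : M} {Y : VField E M} (hY : DiffFieldAt Y x) :
    covDerivEndo nabla J ξ Y x = 0 := by
  -- The formula is now used for `∇` instead of `D`: since `∇ξ = Id` commutes with `J`, only `∇_ξ J`
  -- survives.
  have e := h.torsionFree.lieEndo_eq h.smooth (h.diffFieldAt_xi x) hY
  rw [h.lieEndo_xi hY, h.nabla_xi, h.nabla_xi] at e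
  simpa using e.symm

/-- `∇_ξ (J Y) = J (∇_ξ Y)`. -/
theorem nabla_onField_xi (h : IsConicalAffineSpecialEpsKaehler ε J g D nabla ξ)
    {x : M} {Y : VField E M} (hY : DiffFieldAt Y x) :
    nabla (J.onField Y) x (ξ x) = J x (nabla Y x (ξ x)) :=
  sub_eq_zero.1 (h.covDerivEndo_xi hY)

/-- `∇ (J ξ) = J`. -/
theorem nabla_onField_xi_apply (h : IsConicalAffineSpecialEpsKaehler ε J g D nabla ξ)
    {x : M} {Y : VField E M} (hY : DiffFieldAt Y x) :
    nabla (J.onField ξ) x (Y x) = J x (Y x) := by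
  -- `(∇_Y J)ξ = (∇_ξ J)Y = 0`, and `∇_Y ξ = Y`.
  have e := h.symmetric ξ Y x (h.diffFieldAt_xi x) hY
  rw [h.covDerivEndo_xi hY, covDerivEndo, h.nabla_xi] at e
  exact sub_eq_zero.1 e.symm

/-- `D (J ξ) = J`. -/
theorem D_onField_xi_apply (h : IsConicalAffineSpecialEpsKaehler ε J g D nabla ξ)
    {x : M} {Y : VField E M} (hY : DiffFieldAt Y x) :
    D (J.onField ξ) x (Y x) = J x (Y x) := by
  have e := h.parallel Y ξ x hY (h.diffFieldAt_xi x)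
  rw [covDerivEndo, h.D_xi] at e
  exact sub_eq_zero.1 e

end IsConicalAffineSpecialEpsKaehler

end SpecialKaehler

theorem mainTheorem2 {E : Type*} [NormedAddCommGroup E] [NormedSpace ℝ E] [FiniteDimensional ℝ E]
    {M : Type*} [TopologicalSpace M] [T2Space M] [ChartedSpace E M] [IsManifold 𝓘(ℝ, E) ∞ M]
    (ε : ℝ) (J : SpecialKaehler.Endo E M) (g : SpecialKaehler.Bilin E M)
    (D nabla : SpecialKaehler.Connection E M) (ξ : SpecialKaehler.VField E M)
    (h : SpecialKaehler.IsConicalAffineSpecialEpsKaehler ε J g D nabla ξ) :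
    -- (i) parallel local vector fields
    (∀ (U : Set M) (X : SpecialKaehler.VField E M), IsOpen U →
      SpecialKaehler.SmoothFieldOn X U → SpecialKaehler.ParallelFieldOn nabla X U →
      ∀ x ∈ U, SpecialKaehler.lieField ξ X x = - X x ∧
        SpecialKaehler.lieField ξ (J.onField X) x = - J.onField X x) ∧
    -- (ii) parallel local 1-forms
    (∀ (U : Set M) (α : SpecialKaehler.OneForm E M), IsOpen U →
      SpecialKaehler.SmoothOneFormOn α U → SpecialKaehler.ParallelOneFormOn nabla α U →
      ∀ x ∈ U, ∀ Y : SpecialKaehler.VField E M, SpecialKaehler.DiffFieldAt Y x →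
        SpecialKaehler.lieOneForm ξ α Y x = α.eval Y x ∧
        SpecialKaehler.lieOneForm ξ (J.pullback α) Y x = (J.pullback α).eval Y x) ∧
    -- (iii) Lie derivatives of the structure tensors along `ξ`
    (∀ (x : M) (Y Z : SpecialKaehler.VField E M),
      SpecialKaehler.DiffFieldAt Y x → SpecialKaehler.DiffFieldAt Z x →
        SpecialKaehler.lieBilin ξ (SpecialKaehler.kaehlerForm ε g J) Y Z x =
          2 * (SpecialKaehler.kaehlerForm ε g J).eval Y Z x ∧
        SpecialKaehler.lieBilin ξ g Y Z x = 2 * g.eval Y Z x ∧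
        SpecialKaehler.lieEndo ξ J Y x = 0) ∧
    -- (iv) Lie derivatives of the structure tensors along `J ξ`
    (∀ (x : M) (Y Z : SpecialKaehler.VField E M),
      SpecialKaehler.DiffFieldAt Y x → SpecialKaehler.DiffFieldAt Z x →
        SpecialKaehler.lieBilin (J.onField ξ) (SpecialKaehler.kaehlerForm ε g J) Y Z x = 0 ∧
        SpecialKaehler.lieBilin (J.onField ξ) g Y Z x = 0 ∧
        SpecialKaehler.lieEndo (J.onField ξ) J Y x = 0) := by
  refine ⟨fun U X hU hX hp x hx => ?_, fun U α hU hα hp x hx Y hY => ?_, fun x Y Z hY hZ => ?_,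
    fun x Y Z hY hZ => ?_⟩
  · have hXx := hX.diffFieldAt hU hx
    constructor
    · rw [h.torsionFree.lieField_eq (h.diffFieldAt_xi x) hXx, hp x hx, h.nabla_xi, zero_sub]
    -- `JX` need not be parallel, but its derivative in the direction `ξ` vanishes.
    · rw [h.torsionFree.lieField_eq (h.diffFieldAt_xi x) (h.smooth.diffFieldAt_onField hXx),
        h.nabla_onField_xi hXx, hp x hx, h.nabla_xi, map_zero, zero_sub]
  · constructor
    · rw [hp.lieOneForm_eq h.torsionFree hx (h.diffFieldAt_xi x) hY, h.nabla_xi]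
      rfl
    -- `J^*α` need not be parallel; since `L_ξ` commutes with `J`, `(L_ξ J^*α)(Y) = (L_ξ α)(JY)`.
    · have e := hp.lieOneForm_eq h.torsionFree hx (h.diffFieldAt_xi x)
        (h.smooth.diffFieldAt_onField hY)
      have e' : SpecialKaehler.lieField ξ (J.onField Y) x =
          J x (SpecialKaehler.lieField ξ Y x) := sub_eq_zero.1 (h.lieEndo_xi hY)
      rw [SpecialKaehler.lieOneForm, e', h.nabla_xi] at e
      exact e
  · refine ⟨?_, ?_, h.lieEndo_xi hY⟩
    · rw [h.symplectic.lieBilin_eq h.torsionFree (h.diffFieldAt_xi x) hY hZ, h.nabla_xi,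
        h.nabla_xi, two_mul]
      rfl
    · rw [h.leviCivita.metric.lieBilin_eq h.leviCivita.torsionFree (h.diffFieldAt_xi x) hY hZ,
        h.D_xi, h.D_xi, two_mul]
      rfl
  · have hJξ := h.smooth.diffFieldAt_onField (h.diffFieldAt_xi x)
    refine ⟨?_, ?_, ?_⟩
    · rw [h.symplectic.lieBilin_eq h.torsionFree hJξ hY hZ, h.nabla_onField_xi_apply hY,
        h.nabla_onField_xi_apply hZ]
      -- This is `ω(JY, Z) + ω(Y, JZ)`; skewness of `J` alone cancels it, without `J² = ε`.
      change ε * g x (J x (J x (Y x))) (Z x) + ε * g x (J x (Y x)) (J x (Z x)) = 0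
      rw [h.skew x (J x (Y x)) (Z x)]
      ring
    · rw [h.leviCivita.metric.lieBilin_eq h.leviCivita.torsionFree hJξ hY hZ,
        h.D_onField_xi_apply hY, h.D_onField_xi_apply hZ, h.skew x (Y x) (Z x)]
      ring
    -- `D` is used because `DJ = 0` holds in every direction; what remains is the commutator of
    -- `D(Jξ) = J` with `J`.
    · have hJY := h.D_onField_xi_apply (h.smooth.diffFieldAt_onField hY)
      rw [SpecialKaehler.Endo.onField] at hJY
      rw [h.leviCivita.torsionFree.lieEndo_eq h.smooth hJξ hY, h.parallel _ Y x hJξ hY,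
        h.D_onField_xi_apply hY, hJY]
      abel
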